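/- Let $\mathbf{k}$ be an arbitrary commutative ring. A (right) pre-Lie algebra over $\mathbf{k}$ is a $\mathbf{k}$-module $\mathfrak{g}$ with a $\mathbf{k}$-bilinear product $\circ$ satisfying $$x\circ(y\circ z)-(x\circ y)\circ z = x\circ(z\circ y)-(x\circ z)\circ y\qquad (x,y,z\in\mathfrak{g});$$ its associated Lie algebra is $\mathfrak{g}$ with the bracket $\{x,y\}=x\circ y-y\circ x$. Let $U\mathfrak{g}$ be the universal enveloping algebra of this Lie algebra with its standard Hopf algebra structure (elements $x$ of $\mathfrak{g}$ satisfy $\Delta x=x\otimes 1+1\otimes x$, $\varepsilon(x)=0$, $S(x)=-x$), let $F_nU\mathfrak{g}$ be the span of all products of at most $n$ elements of $\mathfrak{g}$, put $F_{-1}=0$, and let $\operatorname{gr}U\mathfrak{g}=\bigoplus_{n\ge 0}F_n/F_{n-1}$, a commutative graded algebra. Let $\operatorname{Sym}\mathfrak{g}=\bigoplus_n \operatorname{Sym}^n\mathfrak{g}$ be the symmetric algebra, with the coproduct for which the elements of $\mathfrak{g}$ are primitive. Then, for every pre-Lie algebra $\mathfrak{g}$ over $\mathbf{k}$, without any assumption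 on its $\mathbf{k}$-module structure: (i) (graded PBW) $(F_n)_{n\ge 0}$ makes $U\mathfrak{g}$ a filtered Hopf algebra, i.e. it is an increasing exhaustive filtration with $1\in F_0$, $F_iF_j\subseteq F_{i+j}$, $S(F_n)\subseteq F_n$, and $\Delta(F_n)$ contained in $\sum_{i+j=n}\operatorname{im}(F_i\otimes F_j\to U\mathfrak{g}\otimes U\mathfrak{g})$; and the canonical algebra homomorphism $\operatorname{Sym}\mathfrak{g}\to\operatorname{gr}U\mathfrak{g}$, sending $x\in\mathfrak{g}$ to its class in $F_1/F_0$, is an isomorphism. (ii) (quantum PBW) This map lifts to a coalgebra isomorphism: there is an isomorphism of $\mathbf{k}$-coalgebras $\Phi:\operatorname{Sym}\mathfrak{g}\to U\mathfrak{g}$ such that, for all $n\ge 0$ and $x\in\operatorname{Sym}^n\mathfrak{g}$, one has $\Phi(x)\in F_n$ and the class of $\Phi(x)$ in $F_n/F_{n-1}$ is the image of $x$ under the canonical map. In particular, (i) and (ii) hold for the Lie algebra, with bracket $xy-yx$, of every associative (not necessarily unital) $\mathbf{k}$-algebra. -/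

import Mathlib

open scoped TensorProduct DirectSum

noncomputable section

namespace PreLiePBW

attribute [local instance 100] LieRing.ofAssociativeRing

universe u v

/-! ## The Hopf algebra structure on the universal enveloping algebra -/

section Hopf

variable (k : Type u) [CommRing k] (L : Type v) [LieRing L] [LieAlgebra k L]

/-- `U` is the universal enveloping algebra of the Lie algebra `L` over `k`. -/
abbrev U := UniversalEnvelopingAlgebra k L

/-- The canonical map `L → U`, as a linear map. -/
def incl : L →ₗ[k] U k L := (UniversalEnvelopingAlgebra.ι k : L →ₗ⁅k⁆ U k L).toLinearMap

variable {k L}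

theorem incl_lie (x y : L) :
    incl k L ⁅x, y⁆ = incl k L x * incl k L y - incl k L y * incl k L x :=
  (UniversalEnvelopingAlgebra.ι k : L →ₗ⁅k⁆ U k L).map_lie x y

theorem lift_incl {A : Type*} [Ring A] [Algebra k A] (f : L →ₗ⁅k⁆ A) (x : L) :
    UniversalEnvelopingAlgebra.lift k f (incl k L x) = f x :=
  UniversalEnvelopingAlgebra.lift_ι_apply k f x

theorem algHom_ext {A : Type*} [Ring A] [Algebra k A] {f g : U k L →ₐ[k] A}
    (h : ∀ x, f (incl k L x) = g (incl k L x)) : f = g :=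
  UniversalEnvelopingAlgebra.hom_ext k (LieHom.ext h)

theorem adjoin_incl :
    Algebra.adjoin k (Set.range (incl k L)) = ⊤ := by
  rw [eq_top_iff]
  let S := Algebra.adjoin k (Set.range (incl k L))
  let f : L →ₗ⁅k⁆ S :=
    { toFun := fun x => ⟨incl k L x, Algebra.subset_adjoin ⟨x, rfl⟩⟩
      map_add' := fun x y => Subtype.ext (map_add (incl k L) x y)
      map_smul' := fun c x => Subtype.ext (map_smul (incl k L) c x)
      map_lie' := fun {x y} => Subtype.ext (incl_lie x y) }
  have h : S.val.comp (UniversalEnvelopingAlgebra.lift k f) = AlgHom.id k (U k L) := by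
    apply algHom_ext
    intro x
    rw [AlgHom.comp_apply, lift_incl]
    rfl
  intro a _
  have := congrArg (fun g : U k L →ₐ[k] U k L => g a) h
  simp only [AlgHom.comp_apply, AlgHom.id_apply] at this
  rw [← this]
  exact (UniversalEnvelopingAlgebra.lift k f a).2

variable (k L)

/-- The coproduct of `U`: the algebra map with `Δ x = x ⊗ 1 + 1 ⊗ x` for `x ∈ L`. -/
def comulHom : U k L →ₐ[k] U k L ⊗[k] U k L :=
  UniversalEnvelopingAlgebra.lift k
    { toLinearMap := (TensorProduct.mk k (U k L) (U k L)).flip 1 ∘ₗ incl k L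
        + TensorProduct.mk k (U k L) (U k L) 1 ∘ₗ incl k L
      map_lie' := by
        intro x y
        change incl k L ⁅x, y⁆ ⊗ₜ[k] (1 : U k L) + (1 : U k L) ⊗ₜ[k] incl k L ⁅x, y⁆
          = (incl k L x ⊗ₜ[k] (1 : U k L) + (1 : U k L) ⊗ₜ[k] incl k L x)
              * (incl k L y ⊗ₜ[k] (1 : U k L) + (1 : U k L) ⊗ₜ[k] incl k L y)
            - (incl k L y ⊗ₜ[k] (1 : U k L) + (1 : U k L) ⊗ₜ[k] incl k L y)
              * (incl k L x ⊗ₜ[k] (1 : U k L) + (1 : U k L) ⊗ₜ[k] incl k L x)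
        simp only [incl_lie, mul_add, add_mul, Algebra.TensorProduct.tmul_mul_tmul, one_mul,
          mul_one, TensorProduct.sub_tmul, TensorProduct.tmul_sub]
        abel }

/-- The counit of `U`: the algebra map which vanishes on `L`. -/
def counitHom : U k L →ₐ[k] k := UniversalEnvelopingAlgebra.lift k 0

/-- The antipode of `U`, as an algebra map to the opposite algebra: `x ↦ -x` for `x ∈ L`. -/
def antipodeHom : U k L →ₐ[k] (U k L)ᵐᵒᵖ :=
  UniversalEnvelopingAlgebra.lift k
    { toLinearMap := -((MulOpposite.opLinearEquiv k).toLinearMap ∘ₗ incl k L)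
      map_lie' := by
        intro x y
        change -MulOpposite.op (incl k L ⁅x, y⁆)
          = (-MulOpposite.op (incl k L x)) * (-MulOpposite.op (incl k L y))
            - (-MulOpposite.op (incl k L y)) * (-MulOpposite.op (incl k L x))
        simp only [neg_mul_neg, incl_lie, MulOpposite.op_sub, MulOpposite.op_mul]
        abel }

variable {k L}

theorem comulHom_incl (x : L) :
    comulHom k L (incl k L x) = incl k L x ⊗ₜ[k] 1 + 1 ⊗ₜ[k] incl k L x :=
  lift_incl _ x

theorem counitHom_incl (x : L) : counitHom k L (incl k L x) = 0 :=
  lift_incl _ x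

theorem antipodeHom_incl (x : L) :
    antipodeHom k L (incl k L x) = -MulOpposite.op (incl k L x) :=
  lift_incl _ x

variable (k L)

instance instBialgebra : Bialgebra k (U k L) :=
  Bialgebra.ofAlgHom (comulHom k L) (counitHom k L)
    (by
      apply algHom_ext
      intro x
      simp [comulHom_incl, Algebra.TensorProduct.one_def, TensorProduct.add_tmul,
        TensorProduct.tmul_add, add_assoc])
    (by
      apply algHom_ext
      intro x
      simp [comulHom_incl, counitHom_incl])
    (by
      apply algHom_ext
      intro x
      simp [comulHom_incl, counitHom_incl])

variable {k L}

theorem comul_incl (x : L) :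
    Coalgebra.comul (R := k) (incl k L x) = incl k L x ⊗ₜ[k] 1 + 1 ⊗ₜ[k] incl k L x :=
  comulHom_incl x

theorem counit_incl (x : L) : Coalgebra.counit (R := k) (incl k L x) = 0 :=
  counitHom_incl x

variable (k L)

/-- The antipode of `U` as a linear endomorphism. -/
def antipodeLin : U k L →ₗ[k] U k L :=
  (MulOpposite.opLinearEquiv k).symm.toLinearMap ∘ₗ (antipodeHom k L).toLinearMap

variable {k L}

theorem antipodeLin_one : antipodeLin k L 1 = 1 := by simp [antipodeLin]

theorem antipodeLin_mul (a b : U k L) :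
    antipodeLin k L (a * b) = antipodeLin k L b * antipodeLin k L a := by simp [antipodeLin]

theorem antipodeLin_incl (x : L) : antipodeLin k L (incl k L x) = -incl k L x := by
  simp [antipodeLin, antipodeHom_incl]

theorem antipode_left (a : U k L) :
    LinearMap.mul' k (U k L) ((antipodeLin k L).rTensor (U k L) (Coalgebra.comul (R := k) a))
      = algebraMap k (U k L) (Coalgebra.counit (R := k) a) := by
  have ha : a ∈ Algebra.adjoin k (Set.range (incl k L)) := by rw [adjoin_incl]; trivial
  induction ha using Algebra.adjoin_induction with
  | mem x hx =>
    obtain ⟨y, rfl⟩ := hx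
    simp [comul_incl, counit_incl, antipodeLin_incl, antipodeLin_one]
  | algebraMap r =>
    simp [Algebra.TensorProduct.one_def, Algebra.algebraMap_eq_smul_one, antipodeLin_one]
  | add x y _ _ hx hy => simp only [map_add, hx, hy]
  | mul x y _ _ hx hy =>
    have key : ∀ s t : U k L ⊗[k] U k L,
        LinearMap.mul' k (U k L) ((antipodeLin k L).rTensor (U k L) s)
          = algebraMap k (U k L) (Coalgebra.counit (R := k) x) →
        LinearMap.mul' k (U k L) ((antipodeLin k L).rTensor (U k L) (s * t))
          = algebraMap k (U k L) (Coalgebra.counit (R := k) x) *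
            LinearMap.mul' k (U k L) ((antipodeLin k L).rTensor (U k L) t) := by
      intro s t hs
      induction t using TensorProduct.induction_on with
      | zero => simp
      | add t₁ t₂ h₁ h₂ => simp only [mul_add, map_add, h₁, h₂]
      | tmul c d =>
        have : ∀ s : U k L ⊗[k] U k L,
            LinearMap.mul' k (U k L) ((antipodeLin k L).rTensor (U k L) (s * c ⊗ₜ[k] d))
              = antipodeLin k L c *
                LinearMap.mul' k (U k L) ((antipodeLin k L).rTensor (U k L) s) * d := by
          intro s
          induction s using TensorProduct.induction_on with
          | zero => simp
          | add s₁ s₂ h₁ h₂ => simp only [add_mul, mul_add, map_add, h₁, h₂]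
          | tmul p q => simp [antipodeLin_mul, mul_assoc]
        rw [this, hs, ← Algebra.commutes, mul_assoc]
        simp
    rw [Bialgebra.comul_mul, key _ _ hx, hy, Bialgebra.counit_mul, map_mul]

theorem antipode_right (a : U k L) :
    LinearMap.mul' k (U k L) ((antipodeLin k L).lTensor (U k L) (Coalgebra.comul (R := k) a))
      = algebraMap k (U k L) (Coalgebra.counit (R := k) a) := by
  have ha : a ∈ Algebra.adjoin k (Set.range (incl k L)) := by rw [adjoin_incl]; trivial
  induction ha using Algebra.adjoin_induction with
  | mem x hx =>
    obtain ⟨y, rfl⟩ := hx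
    simp [comul_incl, counit_incl, antipodeLin_incl, antipodeLin_one]
  | algebraMap r =>
    simp [Algebra.TensorProduct.one_def, Algebra.algebraMap_eq_smul_one, antipodeLin_one]
  | add x y _ _ hx hy => simp only [map_add, hx, hy]
  | mul x y _ _ hx hy =>
    have key : ∀ s t : U k L ⊗[k] U k L,
        LinearMap.mul' k (U k L) ((antipodeLin k L).lTensor (U k L) t)
          = algebraMap k (U k L) (Coalgebra.counit (R := k) y) →
        LinearMap.mul' k (U k L) ((antipodeLin k L).lTensor (U k L) (s * t))
          = LinearMap.mul' k (U k L) ((antipodeLin k L).lTensor (U k L) s) *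
            algebraMap k (U k L) (Coalgebra.counit (R := k) y) := by
      intro s t ht
      induction s using TensorProduct.induction_on with
      | zero => simp
      | add s₁ s₂ h₁ h₂ => simp only [add_mul, map_add, h₁, h₂]
      | tmul c d =>
        have : ∀ t : U k L ⊗[k] U k L,
            LinearMap.mul' k (U k L) ((antipodeLin k L).lTensor (U k L) (c ⊗ₜ[k] d * t))
              = c * LinearMap.mul' k (U k L) ((antipodeLin k L).lTensor (U k L) t)
                * antipodeLin k L d := by
          intro t
          induction t using TensorProduct.induction_on with
          | zero => simp
          | add s₁ s₂ h₁ h₂ => simp only [add_mul, mul_add, map_add, h₁, h₂]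
          | tmul p q => simp [antipodeLin_mul, mul_assoc]
        rw [this, ht, ← Algebra.commutes, mul_assoc, Algebra.commutes]
        simp
    rw [Bialgebra.comul_mul, key _ _ hy, hx, Bialgebra.counit_mul, map_mul]

/-- The standard Hopf algebra structure on `U`. -/
instance instHopfAlgebra : HopfAlgebra k (U k L) where
  antipode := antipodeLin k L
  mul_antipode_rTensor_comul := LinearMap.ext antipode_left
  mul_antipode_lTensor_comul := LinearMap.ext antipode_right

end Hopf

/-! ## Filtered Hopf algebras -/

/-- `F` makes the Hopf algebra `H` a filtered Hopf algebra: `F 0 ⊆ F 1 ⊆ ⋯` is an exhaustive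
filtration of `H` preserved by all structure maps. Here `F i ⊗ F j` is understood through its
image in `H ⊗ H`. -/
structure IsHopfFiltration (k : Type u) [CommRing k] (H : Type v) [Ring H] [HopfAlgebra k H]
    (F : ℕ → Submodule k H) : Prop where
  mono : Monotone F
  exhaustive : ⨆ n, F n = ⊤
  one_mem : (1 : H) ∈ F 0
  mul_le : ∀ i j, F i * F j ≤ F (i + j)
  comul_le : ∀ n, (F n).map (Coalgebra.comul (R := k) (A := H)) ≤
    ⨆ p ∈ Finset.HasAntidiagonal.antidiagonal n,
      LinearMap.range (TensorProduct.map (F p.1).subtype (F p.2).subtype)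
  antipode_le : ∀ n, (F n).map (HopfAlgebra.antipode k (A := H)) ≤ F n

/-! ## The associated graded algebra of the enveloping algebra -/

section Gr

variable (k : Type u) [CommRing k] (L : Type v) [LieRing L] [LieAlgebra k L]

/-- `k + L ⊆ U`. -/
def V : Submodule k (U k L) := 1 ⊔ LinearMap.range (incl k L)

/-- The standard filtration of `U`: `F n = (k + L) ^ n` is the span of all products of at most
`n` elements of `L`. -/
def F (n : ℕ) : Submodule k (U k L) := V k L ^ n

/-- `Fprev n` is `F (n - 1)`, with the convention `F (-1) = 0`. -/
def Fprev : ℕ → Submodule k (U k L)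
  | 0 => ⊥
  | n + 1 => F k L n

/-- The degree `n` part `F n / F (n - 1)` of the associated graded algebra of `U`. -/
abbrev GrPiece (n : ℕ) : Type (max u v) := F k L n ⧸ (Fprev k L n).submoduleOf (F k L n)

/-- The symbol map `F n → F n / F (n - 1)`. -/
abbrev symb (n : ℕ) : F k L n →ₗ[k] GrPiece k L n :=
  ((Fprev k L n).submoduleOf (F k L n)).mkQ

variable {k L}

theorem one_le_V : (1 : Submodule k (U k L)) ≤ V k L := le_sup_left

theorem incl_mem_V (x : L) : incl k L x ∈ V k L :=
  (le_sup_right : LinearMap.range (incl k L) ≤ V k L) ⟨x, rfl⟩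

theorem one_mem_F : (1 : U k L) ∈ F k L 0 := by
  rw [F, pow_zero]; exact Submodule.one_le.mp le_rfl

theorem algebraMap_mem_F (r : k) : algebraMap k (U k L) r ∈ F k L 0 := by
  rw [F, pow_zero]; exact Submodule.algebraMap_mem r

theorem incl_mem_F (x : L) : incl k L x ∈ F k L 1 := by
  rw [F, pow_one]; exact incl_mem_V x

theorem F_mul_F (i j : ℕ) : F k L i * F k L j = F k L (i + j) := (pow_add _ _ _).symm

theorem mul_mem_F {i j : ℕ} {a b : U k L} (ha : a ∈ F k L i) (hb : b ∈ F k L j) :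
    a * b ∈ F k L (i + j) := by
  rw [← F_mul_F]; exact Submodule.mul_mem_mul ha hb

theorem F_le_succ (n : ℕ) : F k L n ≤ F k L (n + 1) :=
  calc F k L n = F k L n * 1 := (mul_one _).symm
    _ ≤ F k L n * V k L := mul_le_mul_right one_le_V _
    _ = F k L (n + 1) := (pow_succ _ _).symm

theorem F_mono : Monotone (F k L) := monotone_nat_of_le_succ F_le_succ

theorem mul_mem_Fprev_left {i j : ℕ} {a b : U k L} (ha : a ∈ Fprev k L i) (hb : b ∈ F k L j) :
    a * b ∈ Fprev k L (i + j) := by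
  cases i with
  | zero =>
    have : a = 0 := ha
    rw [this, zero_mul]; exact zero_mem _
  | succ i =>
    rw [Nat.add_right_comm]
    exact mul_mem_F ha hb

theorem mul_mem_Fprev_right {i j : ℕ} {a b : U k L} (ha : a ∈ F k L i) (hb : b ∈ Fprev k L j) :
    a * b ∈ Fprev k L (i + j) := by
  cases j with
  | zero =>
    have : b = 0 := hb
    rw [this, mul_zero]; exact zero_mem _
  | succ j => exact mul_mem_F ha hb

theorem comm_V {v w : U k L} (hv : v ∈ V k L) (hw : w ∈ V k L) : v * w - w * v ∈ V k L := by
  obtain ⟨r, hr, x', ⟨x, rfl⟩, rfl⟩ := Submodule.mem_sup.mp hv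
  obtain ⟨s, hs, y', ⟨y, rfl⟩, rfl⟩ := Submodule.mem_sup.mp hw
  obtain ⟨r, rfl⟩ := Submodule.mem_one.mp hr
  obtain ⟨s, rfl⟩ := Submodule.mem_one.mp hs
  have : (algebraMap k (U k L) r + incl k L x) * (algebraMap k (U k L) s + incl k L y)
      - (algebraMap k (U k L) s + incl k L y) * (algebraMap k (U k L) r + incl k L x)
      = incl k L ⁅x, y⁆ := by
    rw [incl_lie]
    simp only [mul_add, add_mul, Algebra.commutes r (incl k L y),
      Algebra.commutes s (incl k L x), Algebra.commutes r (algebraMap k (U k L) s)]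
    abel
  rw [this]
  exact incl_mem_V _

theorem comm_V_F {v : U k L} (hv : v ∈ V k L) {n : ℕ} {a : U k L} (ha : a ∈ F k L n) :
    v * a - a * v ∈ F k L n := by
  induction ha using Submodule.pow_induction_on_left' with
  | algebraMap r => rw [Algebra.commutes, sub_self]; exact zero_mem _
  | add x y i _ _ hx hy =>
    have : v * (x + y) - (x + y) * v = (v * x - x * v) + (v * y - y * v) := by noncomm_ring
    rw [this]; exact add_mem hx hy
  | mem_mul m hm i x hx h =>
    have : v * (m * x) - m * x * v = (v * m - m * v) * x + m * (v * x - x * v) := by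
      noncomm_ring
    rw [this]
    change _ ∈ V k L ^ (i + 1)
    rw [pow_succ']
    exact add_mem (Submodule.mul_mem_mul (comm_V hv hm) hx) (Submodule.mul_mem_mul hm h)

/-- Commutators drop the filtration degree by one. -/
theorem comm_F {i j : ℕ} {a b : U k L} (ha : a ∈ F k L i) (hb : b ∈ F k L j) :
    a * b - b * a ∈ Fprev k L (i + j) := by
  induction ha using Submodule.pow_induction_on_left' with
  | algebraMap r => rw [Algebra.commutes, sub_self]; exact zero_mem _
  | add x y i _ _ hx hy =>
    have : (x + y) * b - b * (x + y) = (x * b - b * x) + (y * b - b * y) := by noncomm_ring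
    rw [this]; exact add_mem hx hy
  | mem_mul m hm i x hx h =>
    have e : m * x * b - b * (m * x) = m * (x * b - b * x) + (m * b - b * m) * x := by
      noncomm_ring
    rw [e]
    refine add_mem ?_ ?_
    · have hm' : m ∈ F k L 1 := by rw [F, pow_one]; exact hm
      have := mul_mem_Fprev_right hm' h
      rwa [show i.succ + j = 1 + (i + j) by omega]
    · have := mul_mem_F (comm_V_F hm hb) (show x ∈ F k L i from hx)
      rw [show i.succ + j = (j + i) + 1 by omega]
      exact this

theorem symb_eq_iff {n : ℕ} (a b : F k L n) :
    symb k L n a = symb k L n b ↔ (a : U k L) - b ∈ Fprev k L n :=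
  Submodule.Quotient.eq _

theorem symb_surj {n : ℕ} (x : GrPiece k L n) : ∃ a, symb k L n a = x :=
  Submodule.mkQ_surjective _ x

/-- Multiplication `F i → F j → F (i + j)`. -/
def mulF {i j : ℕ} (a : F k L i) (b : F k L j) : F k L (i + j) := ⟨a * b, mul_mem_F a.2 b.2⟩

/-- The product of the associated graded algebra: the product of the classes of `a` and `b` is
the class of `a * b`. -/
def grMul {i j : ℕ} (x : GrPiece k L i) (y : GrPiece k L j) : GrPiece k L (i + j) :=
  Quotient.liftOn₂' x y (fun a b => symb k L (i + j) (mulF a b)) (by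
    intro a₁ b₁ a₂ b₂ ha hb
    have ha' : (a₁ : U k L) - a₂ ∈ Fprev k L i := (symb_eq_iff a₁ a₂).mp (Quotient.sound' ha)
    have hb' : (b₁ : U k L) - b₂ ∈ Fprev k L j := (symb_eq_iff b₁ b₂).mp (Quotient.sound' hb)
    rw [symb_eq_iff]
    have : ((mulF a₁ b₁ : F k L (i + j)) : U k L) - (mulF a₂ b₂ : F k L (i + j))
        = ((a₁ : U k L) - a₂) * b₁ + a₂ * ((b₁ : U k L) - b₂) := by
      simp only [mulF]; noncomm_ring
    rw [this]
    exact add_mem (mul_mem_Fprev_left ha' b₁.2) (mul_mem_Fprev_right a₂.2 hb'))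

theorem grMul_symb {i j : ℕ} (a : F k L i) (b : F k L j) :
    grMul (symb k L i a) (symb k L j b) = symb k L (i + j) (mulF a b) := rfl

theorem graded_eq {i j : ℕ} (h : i = j) (a : F k L i) (b : F k L j)
    (hab : (a : U k L) - b ∈ Fprev k L j) :
    (GradedMonoid.mk i (symb k L i a) : GradedMonoid (GrPiece k L))
      = GradedMonoid.mk j (symb k L j b) := by
  subst h
  rw [(symb_eq_iff a b).mpr hab]

theorem graded_eq' {i j : ℕ} (h : i = j) (a : F k L i) (b : F k L j)
    (hab : (a : U k L) = b) :
    (GradedMonoid.mk i (symb k L i a) : GradedMonoid (GrPiece k L))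
      = GradedMonoid.mk j (symb k L j b) :=
  graded_eq h a b (by rw [hab, sub_self]; exact zero_mem _)

variable (k L)

instance instGMul : GradedMonoid.GMul (GrPiece k L) where
  mul := grMul

instance instGOne : GradedMonoid.GOne (GrPiece k L) where
  one := symb k L 0 ⟨1, one_mem_F⟩

instance instGMonoid : GradedMonoid.GMonoid (GrPiece k L) where
  __ := instGMul k L
  __ := instGOne k L
  one_mul := by
    rintro ⟨i, x⟩
    obtain ⟨a, rfl⟩ := symb_surj x
    exact graded_eq' (zero_add i) _ _ (one_mul _)
  mul_one := by
    rintro ⟨i, x⟩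
    obtain ⟨a, rfl⟩ := symb_surj x
    exact graded_eq' (add_zero i) _ _ (mul_one _)
  mul_assoc := by
    rintro ⟨i, x⟩ ⟨j, y⟩ ⟨l, z⟩
    obtain ⟨a, rfl⟩ := symb_surj x
    obtain ⟨b, rfl⟩ := symb_surj y
    obtain ⟨c, rfl⟩ := symb_surj z
    exact graded_eq' (add_assoc i j l) _ _ (mul_assoc _ _ _)

instance instGCommRing : DirectSum.GCommRing (GrPiece k L) where
  __ := instGMonoid k L
  mul_zero := by
    intro i j x
    obtain ⟨a, rfl⟩ := symb_surj x
    rw [← map_zero (symb k L j)]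
    refine (grMul_symb _ _).trans ?_
    rw [← map_zero (symb k L (i + j))]
    exact congrArg _ (Subtype.ext (mul_zero _))
  zero_mul := by
    intro i j x
    obtain ⟨a, rfl⟩ := symb_surj x
    rw [← map_zero (symb k L i)]
    refine (grMul_symb _ _).trans ?_
    rw [← map_zero (symb k L (i + j))]
    exact congrArg _ (Subtype.ext (zero_mul _))
  mul_add := by
    intro i j x y z
    obtain ⟨a, rfl⟩ := symb_surj x
    obtain ⟨b, rfl⟩ := symb_surj y
    obtain ⟨c, rfl⟩ := symb_surj z
    exact congrArg (symb k L (i + j)) (Subtype.ext (mul_add (a : U k L) b c))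
  add_mul := by
    intro i j x y z
    obtain ⟨a, rfl⟩ := symb_surj x
    obtain ⟨b, rfl⟩ := symb_surj y
    obtain ⟨c, rfl⟩ := symb_surj z
    exact congrArg (symb k L (i + j)) (Subtype.ext (add_mul (a : U k L) b c))
  natCast n := n • symb k L 0 ⟨1, one_mem_F⟩
  natCast_zero := zero_smul _ _
  natCast_succ n := succ_nsmul _ n
  intCast n := n • symb k L 0 ⟨1, one_mem_F⟩
  intCast_ofNat n := natCast_zsmul _ n
  intCast_negSucc_ofNat n := negSucc_zsmul _ n
  mul_comm := by
    rintro ⟨i, x⟩ ⟨j, y⟩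
    obtain ⟨a, rfl⟩ := symb_surj x
    obtain ⟨b, rfl⟩ := symb_surj y
    refine graded_eq (add_comm i j) (mulF a b) (mulF b a) ?_
    have h := comm_F a.2 b.2
    rw [add_comm i j] at h
    exact h

instance instGAlgebra : DirectSum.GAlgebra k (GrPiece k L) where
  toFun :=
    { toFun := fun r => symb k L 0 ⟨algebraMap k (U k L) r, algebraMap_mem_F r⟩
      map_zero' := by
        rw [← map_zero (symb k L 0)]
        exact congrArg _ (Subtype.ext (map_zero _))
      map_add' := fun r s => by
        rw [← map_add (symb k L 0)]
        exact congrArg _ (Subtype.ext (map_add _ r s)) }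
  map_one := congrArg (symb k L 0) (Subtype.ext (map_one (algebraMap k (U k L))))
  map_mul r s := graded_eq' (zero_add 0).symm ⟨algebraMap k (U k L) (r * s), algebraMap_mem_F _⟩
    (mulF ⟨algebraMap k (U k L) r, algebraMap_mem_F r⟩
      ⟨algebraMap k (U k L) s, algebraMap_mem_F s⟩) (map_mul (algebraMap k (U k L)) r s)
  commutes r := by
    rintro ⟨i, x⟩
    obtain ⟨a, rfl⟩ := symb_surj x
    exact graded_eq' (add_comm 0 i) (mulF _ _) (mulF _ _) (Algebra.commutes r (a : U k L))
  smul_def r := by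
    rintro ⟨i, x⟩
    obtain ⟨a, rfl⟩ := symb_surj x
    exact graded_eq' (zero_add i).symm (r • a) (mulF _ _) (Algebra.smul_def r (a : U k L))

/-- The associated graded algebra `gr U = ⨁ n, F n / F (n - 1)`, a commutative graded algebra. -/
abbrev Gr := ⨁ n, GrPiece k L n

/-- The canonical algebra map `Sym L → gr U`, which sends `x ∈ L` to the class of `x` in
`F 1 / F 0`. -/
def canonicalMap : SymmetricAlgebra k L →ₐ[k] Gr k L :=
  SymmetricAlgebra.lift (A := Gr k L)
    (DirectSum.lof k ℕ (GrPiece k L) 1 ∘ₗ symb k L 1 ∘ₗ (incl k L).codRestrict (F k L 1) incl_mem_F)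

/-- The degree `n` part of the symmetric algebra: the span of products of `n` elements of `L`. -/
def symPart (n : ℕ) : Submodule k (SymmetricAlgebra k L) :=
  LinearMap.range (SymmetricAlgebra.ι k L) ^ n

/-- A linear map `Φ : Sym L → U` lifts the canonical map `Sym L → gr U`: it maps elements `x` of
degree `n` to `F n`, and the class of `Φ x` in `F n / F (n - 1)` is the image of `x` under the
canonical map. -/
def LiftsCanonicalMap (Φ : SymmetricAlgebra k L →ₗ[k] U k L) : Prop :=
  ∀ n, ∀ x ∈ symPart k L n, ∃ h : Φ x ∈ F k L n,
    canonicalMap k L x = DirectSum.of (GrPiece k L) n (symb k L n ⟨Φ x, h⟩)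

/-- The PBW theorem holds for the Lie algebra `L`. -/
structure SatisfiesPBW : Prop where
  /-- The standard filtration makes `U` a filtered Hopf algebra. -/
  filteredHopf : IsHopfFiltration k (U k L) (F k L)
  /-- Graded PBW: the canonical map is an isomorphism of algebras. -/
  graded : Function.Bijective (canonicalMap k L)
  /-- Quantum PBW: the canonical map lifts to an isomorphism of coalgebras. -/
  quantum : ∃ Φ : SymmetricAlgebra k L ≃ₗc[k] U k L,
    LiftsCanonicalMap k L Φ.toLinearEquiv.toLinearMap

end Gr

/-- An associative ring, not necessarily unital, is a right pre-Lie ring. -/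
abbrev rightPreLieRingOfAssociative (A : Type v) [NonUnitalRing A] : RightPreLieRing A where
  assoc_symm' x y z := by simp [associator_apply, mul_assoc]

/-- An associative algebra, not necessarily unital, is a right pre-Lie algebra. -/
abbrev rightPreLieAlgebraOfAssociative (k : Type u) [CommRing k] (A : Type v) [NonUnitalRing A]
    [Module k A] [IsScalarTower k A A] [SMulCommClass k A A] :
    letI := rightPreLieRingOfAssociative A
    RightPreLieAlgebra k A :=
  letI := rightPreLieRingOfAssociative A
  { }

end PreLiePBW

end

noncomputable section

namespace PreLiePBW

open Polynomial Coalgebra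

attribute [local instance 100] LieRing.ofAssociativeRing

/-! ## The standard filtration is a filtration of Hopf algebras -/

section Filtration

variable (k : Type u) [CommRing k] (L : Type v) [LieRing L] [LieAlgebra k L]

/-! The pre-Lie product makes `Sym g` a right `U`-module. Let `D_y` be the derivation of `Sym g`
extending `x ↦ x ∘ y`, and let `y` act by `a ↦ a · y + D_y a`. The pre-Lie identity says exactly
that `D` of a bracket is the commutator of the `D`s (in reverse order, the action being on the
right), and the Leibniz cross terms supply multiplication by the bracket (`preLieDeriv_lie`,
`preLieAct_lie`). Acting on `1` then gives a linear map `toSym : U → Sym g`.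

This map is triangular: `D_y` preserves degree while multiplication by `y` raises it by one, so `x₁
⋯ xₙ` in `U` goes to the same product in `Sym g` plus terms of degree below `n`. Leading terms
therefore invert the canonical map `Sym g → gr U`, and induction on degree makes `toSym` itself
bijective. It respects coproducts because multiplication by a primitive element and `D_y` are both
coderivations (`comul_preLieAct`). Its inverse is the map of quantum PBW.

Only universal properties and degree counting enter: no basis, flatness or division is needed, so
the module structure of `g` plays no role. The compatibility of the filtration with the Hopf
structure holds for every Lie algebra and is checked on generators. -/

/-- The induced filtration of `U ⊗ U`. -/
def tensorF (n : ℕ) : Submodule k (U k L ⊗[k] U k L) :=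
  ⨆ p ∈ Finset.HasAntidiagonal.antidiagonal n,
    LinearMap.range (TensorProduct.map (F k L p.1).subtype (F k L p.2).subtype)

variable {k L}

theorem tmul_mem_tensorF {i j n : ℕ} (h : i + j = n) {a b : U k L} (ha : a ∈ F k L i)
    (hb : b ∈ F k L j) : a ⊗ₜ[k] b ∈ tensorF k L n :=
  Submodule.mem_iSup_of_mem (i, j) <| Submodule.mem_iSup_of_mem
    (Finset.HasAntidiagonal.mem_antidiagonal.mpr h) ⟨(⟨a, ha⟩ : F k L i) ⊗ₜ (⟨b, hb⟩ : F k L j), rfl⟩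

theorem tensorF_le {n : ℕ} {N : Submodule k (U k L ⊗[k] U k L)}
    (h : ∀ i j, i + j = n → ∀ a ∈ F k L i, ∀ b ∈ F k L j, a ⊗ₜ[k] b ∈ N) :
    tensorF k L n ≤ N := by
  refine iSup₂_le fun p hp => ?_
  rintro _ ⟨t, rfl⟩
  induction t using TensorProduct.induction_on with
  | zero => simp
  | add s t hs ht => rw [map_add]; exact add_mem hs ht
  | tmul a b => exact h _ _ (Finset.HasAntidiagonal.mem_antidiagonal.mp hp) _ a.2 _ b.2

theorem symb_eq_zero_iff {n : ℕ} {u : U k L} (hu : u ∈ F k L n) :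
    symb k L n ⟨u, hu⟩ = 0 ↔ u ∈ Fprev k L n := by
  rw [← map_zero (symb k L n), symb_eq_iff, Submodule.coe_zero, sub_zero]

theorem tensorF_le_succ (n : ℕ) : tensorF k L n ≤ tensorF k L (n + 1) :=
  tensorF_le fun i j h _ ha _ hb =>
    tmul_mem_tensorF (show i + 1 + j = n + 1 by omega) (F_le_succ i ha) hb

theorem mul_incl_mem_F {n : ℕ} {a : U k L} (ha : a ∈ F k L n) (x : L) :
    a * incl k L x ∈ F k L (n + 1) :=
  mul_mem_F ha (incl_mem_F x)

theorem tensorF_mul_primitive {n : ℕ} {t : U k L ⊗[k] U k L} (ht : t ∈ tensorF k L n) (x : L) :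
    t * (incl k L x ⊗ₜ[k] 1 + 1 ⊗ₜ[k] incl k L x) ∈ tensorF k L (n + 1) := by
  refine tensorF_le (N := (tensorF k L (n + 1)).comap
    (LinearMap.mulRight k (incl k L x ⊗ₜ[k] 1 + 1 ⊗ₜ[k] incl k L x))) ?_ ht
  intro i j h a ha b hb
  simp only [Submodule.mem_comap, LinearMap.mulRight_apply, mul_add,
    Algebra.TensorProduct.tmul_mul_tmul, mul_one]
  exact add_mem (tmul_mem_tensorF (by omega) (mul_incl_mem_F ha x) hb)
    (tmul_mem_tensorF (by omega) ha (mul_incl_mem_F hb x))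

/-- Induction along the standard filtration, multiplying by elements of `L` on the right. -/
@[elab_as_elim]
theorem F_induction {motive : ∀ n a, a ∈ F k L n → Prop}
    (algebraMap : ∀ r, motive 0 (algebraMap k (U k L) r) (algebraMap_mem_F r))
    (add : ∀ n a b ha hb, motive n a ha → motive n b hb → motive n (a + b) (add_mem ha hb))
    (smul_succ : ∀ n a (r : k) ha, motive n a ha →
      motive (n + 1) (r • a) (Submodule.smul_mem _ r (F_le_succ n ha)))
    (mul_incl : ∀ n a x ha, motive n a ha →
      motive (n + 1) (a * incl k L x) (mul_incl_mem_F ha x))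
    {n : ℕ} {a : U k L} (ha : a ∈ F k L n) : motive n a ha := by
  refine Submodule.pow_induction_on_right' (V k L) (C := motive) algebraMap
    (fun x y i hx hy h₁ h₂ => add i x y hx hy h₁ h₂) (fun i x hx h m hm => ?_) ha
  obtain ⟨s, hs, y', ⟨y, rfl⟩, rfl⟩ := Submodule.mem_sup.mp hm
  obtain ⟨s, rfl⟩ := Submodule.mem_one.mp hs
  have e : x * (Algebra.algebraMap k (U k L) s + incl k L y) = s • x + x * incl k L y := by
    rw [mul_add, ← Algebra.commutes, ← Algebra.smul_def]
  -- The motive depends on the membership proof, so the element is generalised before `e` is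
  -- substituted.
  have key : ∀ (b : U k L) (hb : b ∈ F k L (i + 1)), b = s • x + x * incl k L y →
      motive (i + 1) b hb := by
    rintro _ hb rfl
    exact add _ _ _ _ _ (smul_succ _ _ _ hx h) (mul_incl _ _ _ hx h)
  exact key _ _ e

theorem comul_mem_tensorF {n : ℕ} {a : U k L} (ha : a ∈ F k L n) :
    comul (R := k) a ∈ tensorF k L n := by
  induction ha using F_induction with
  | algebraMap r =>
    rw [Algebra.algebraMap_eq_smul_one, map_smul, Bialgebra.comul_one,
      Algebra.TensorProduct.one_def]
    exact Submodule.smul_mem _ _ (tmul_mem_tensorF (zero_add 0) one_mem_F one_mem_F)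
  | add n a b _ _ ha hb => rw [map_add]; exact add_mem ha hb
  | smul_succ n a r _ h => rw [map_smul]; exact Submodule.smul_mem _ _ (tensorF_le_succ n h)
  | mul_incl n a x _ h => rw [Bialgebra.comul_mul, comul_incl]; exact tensorF_mul_primitive h x

theorem antipodeLin_mem_F {n : ℕ} {a : U k L} (ha : a ∈ F k L n) :
    antipodeLin k L a ∈ F k L n := by
  induction ha using F_induction with
  | algebraMap r =>
    rw [Algebra.algebraMap_eq_smul_one, map_smul, antipodeLin_one]
    exact Submodule.smul_mem _ _ one_mem_F
  | add n a b _ _ ha hb => rw [map_add]; exact add_mem ha hb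
  | smul_succ n a r _ h => rw [map_smul]; exact Submodule.smul_mem _ _ (F_le_succ n h)
  | mul_incl n a x _ h =>
    -- The antipode reverses products, so the factor of degree one now stands on the left and the
    -- degree must read `1 + n`.
    rw [antipodeLin_mul, antipodeLin_incl, add_comm]
    exact mul_mem_F (neg_mem (incl_mem_F x)) h

theorem exists_mem_F (a : U k L) : ∃ n, a ∈ F k L n := by
  have ha : a ∈ Algebra.adjoin k (Set.range (incl k L)) := by rw [adjoin_incl]; trivial
  induction ha using Algebra.adjoin_induction with
  | mem x hx => obtain ⟨y, rfl⟩ := hx; exact ⟨1, incl_mem_F y⟩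
  | algebraMap r => exact ⟨0, algebraMap_mem_F r⟩
  | add x y _ _ hx hy =>
    obtain ⟨i, hi⟩ := hx
    obtain ⟨j, hj⟩ := hy
    exact ⟨max i j, add_mem (F_mono (le_max_left i j) hi) (F_mono (le_max_right i j) hj)⟩
  | mul x y _ _ hx hy =>
    obtain ⟨i, hi⟩ := hx
    obtain ⟨j, hj⟩ := hy
    exact ⟨i + j, mul_mem_F hi hj⟩

variable (k L)

theorem isHopfFiltration_F : IsHopfFiltration k (U k L) (F k L) where
  mono := F_mono
  exhaustive := eq_top_iff.mpr fun a _ =>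
    (exists_mem_F a).elim fun n hn => Submodule.mem_iSup_of_mem n hn
  one_mem := one_mem_F
  mul_le i j := (F_mul_F i j).le
  comul_le _ := Submodule.map_le_iff_le_comap.mpr fun _ ha => comul_mem_tensorF ha
  antipode_le _ := Submodule.map_le_iff_le_comap.mpr fun _ ha => antipodeLin_mem_F ha

end Filtration

/-! ## Derivations and the grading of the symmetric algebra -/

section Sym

variable {k : Type u} [CommRing k] {M : Type v} [AddCommGroup M] [Module k M]

local notation "S" => SymmetricAlgebra k M

/-- The algebra map `a ↦ a + D a ε` to the dual numbers, for `D` the derivation with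
`D (ι x) = f x`. -/
def symDualHom (f : M →ₗ[k] S) : S →ₐ[k] DualNumber S :=
  SymmetricAlgebra.lift
    ((TrivSqZeroExt.inlAlgHom k S S).toLinearMap ∘ₗ SymmetricAlgebra.ι k M
      + (TrivSqZeroExt.inrHom S S).restrictScalars k ∘ₗ f)

theorem symDualHom_ι (f : M →ₗ[k] S) (x : M) :
    symDualHom f (SymmetricAlgebra.ι k M x)
      = TrivSqZeroExt.inl (SymmetricAlgebra.ι k M x) + TrivSqZeroExt.inr (f x) :=
  SymmetricAlgebra.lift_ι_apply _ x

/-- An algebra map to the dual numbers has a derivation as its `ε`-part once its constant part is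
the identity. In this way the universal property of `Sym`, which only produces algebra maps, also
produces derivations. -/
theorem fst_symDualHom (f : M →ₗ[k] S) (a : S) : (symDualHom f a).fst = a := by
  have h : (TrivSqZeroExt.fstHom k S S).comp (symDualHom f) = AlgHom.id k S := by
    apply SymmetricAlgebra.algHom_ext
    ext x
    simp [symDualHom_ι]
  exact congrArg (fun g : S →ₐ[k] S => g a) h

/-- The derivation of the symmetric algebra with prescribed values on generators. -/
def symDeriv (f : M →ₗ[k] S) : Derivation k S S :=
  Derivation.mk'
    ((TrivSqZeroExt.sndHom S S).restrictScalars k ∘ₗ (symDualHom f).toLinearMap)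
    (by
      intro a b
      simp [fst_symDualHom, mul_comm])

@[simp]
theorem symDeriv_ι (f : M →ₗ[k] S) (x : M) : symDeriv f (SymmetricAlgebra.ι k M x) = f x := by
  simp [symDeriv, symDualHom_ι]

theorem symDerivation_ext {N : Type*} [AddCommGroup N] [Module k N] [Module S N]
    {D E : Derivation k S N}
    (h : ∀ x, D (SymmetricAlgebra.ι k M x) = E (SymmetricAlgebra.ι k M x)) : D = E := by
  ext a
  induction a using SymmetricAlgebra.induction with
  | algebraMap r => simp
  | ι x => exact h x
  | mul a b ha hb => simp [ha, hb]
  | add a b ha hb => simp [ha, hb]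

variable (k M)

/-- The algebra map `a ↦ ∑ aₙ Xⁿ`, where `aₙ` is the homogeneous part of degree `n` of `a`. -/
def gradeHom : S →ₐ[k] S[X] :=
  SymmetricAlgebra.lift ((monomial (R := S) 1).restrictScalars k ∘ₗ SymmetricAlgebra.ι k M)

/-- The elements of degree less than `n` of the symmetric algebra. -/
def symLT (n : ℕ) : Submodule k S :=
  ((degreeLT S n).restrictScalars k).comap (gradeHom k M).toLinearMap

variable {k M}

@[simp]
theorem gradeHom_ι (x : M) :
    gradeHom k M (SymmetricAlgebra.ι k M x) = monomial 1 (SymmetricAlgebra.ι k M x) :=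
  SymmetricAlgebra.lift_ι_apply _ x

theorem mem_symLT {n : ℕ} {a : S} : a ∈ symLT k M n ↔ ∀ m, n ≤ m → (gradeHom k M a).coeff m = 0 := by
  change gradeHom k M a ∈ degreeLT S n ↔ _
  rw [mem_degreeLT, degree_lt_iff_coeff_zero]

/-- Setting `X = 1` sums the homogeneous parts, so an element is determined by them. -/
theorem eval_one_gradeHom (a : S) : (gradeHom k M a).eval 1 = a := by
  have h : ((aeval (1 : S)).restrictScalars k).comp (gradeHom k M) = AlgHom.id k S := by
    apply SymmetricAlgebra.algHom_ext
    ext x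
    simp [coe_aeval_eq_eval]
  have := congrArg (fun g : S →ₐ[k] S => g a) h
  simpa [coe_aeval_eq_eval] using this

theorem symLT_zero : symLT k M 0 = ⊥ := by
  refine eq_bot_iff.mpr fun a ha => ?_
  have h : gradeHom k M a = 0 := by
    ext m
    simpa using mem_symLT.mp ha m (Nat.zero_le m)
  rw [Submodule.mem_bot, ← eval_one_gradeHom a, h, eval_zero]

theorem symLT_mono : Monotone (symLT k M) := fun _ _ h _ ha =>
  mem_symLT.mpr fun m hm => mem_symLT.mp ha m (h.trans hm)

theorem exists_mem_symLT (a : S) : ∃ n, a ∈ symLT k M n :=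
  ⟨(gradeHom k M a).natDegree + 1, mem_symLT.mpr fun _ hm => coeff_eq_zero_of_natDegree_lt hm⟩

theorem mul_ι_mem_symLT {n : ℕ} {a : S} (ha : a ∈ symLT k M n) (x : M) :
    a * SymmetricAlgebra.ι k M x ∈ symLT k M (n + 1) := by
  refine mem_symLT.mpr fun m hm => ?_
  obtain ⟨m, rfl⟩ : ∃ l, m = l + 1 := ⟨m - 1, by omega⟩
  rw [map_mul, gradeHom_ι, coeff_mul_monomial, mem_symLT.mp ha m (by omega), zero_mul]

/-- A derivation sending generators to generators is homogeneous of degree zero. This makes the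
derivation part of the action a lower-order correction. -/
theorem coeff_gradeHom_symDeriv (f : M →ₗ[k] M) (a : S) (m : ℕ) :
    (gradeHom k M (symDeriv (SymmetricAlgebra.ι k M ∘ₗ f) a)).coeff m
      = symDeriv (SymmetricAlgebra.ι k M ∘ₗ f) ((gradeHom k M a).coeff m) := by
  induction a using SymmetricAlgebra.induction generalizing m with
  | algebraMap r =>
    rw [Derivation.map_algebraMap, map_zero, coeff_zero, AlgHom.commutes,
      Polynomial.algebraMap_apply, coeff_C]
    split_ifs <;> simp
  | ι x =>
    rw [symDeriv_ι, LinearMap.comp_apply, gradeHom_ι, gradeHom_ι, coeff_monomial, coeff_monomial]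
    split_ifs <;> simp
  | mul a b ha hb =>
    simp only [Derivation.leibniz, smul_eq_mul, map_add, map_mul, mul_comm (gradeHom k M b),
      coeff_add, coeff_mul, ha, hb, map_sum, Finset.sum_add_distrib,
      mul_comm (symDeriv (SymmetricAlgebra.ι k M ∘ₗ f) _)]
  | add a b ha hb => simp only [map_add, coeff_add, ha, hb]

theorem symDeriv_mem_symLT (f : M →ₗ[k] M) {n : ℕ} {a : S} (ha : a ∈ symLT k M n) :
    symDeriv (SymmetricAlgebra.ι k M ∘ₗ f) a ∈ symLT k M n := by
  refine mem_symLT.mpr fun m hm => ?_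
  rw [coeff_gradeHom_symDeriv, mem_symLT.mp ha m hm, map_zero]

theorem coeff_gradeHom_mem (a : S) (n : ℕ) :
    (gradeHom k M a).coeff n ∈ LinearMap.range (SymmetricAlgebra.ι k M) ^ n := by
  induction a using SymmetricAlgebra.induction generalizing n with
  | algebraMap r =>
    rw [AlgHom.commutes, Polynomial.algebraMap_apply, coeff_C]
    split_ifs with h
    · subst h
      rw [pow_zero]
      exact Submodule.algebraMap_mem r
    · exact zero_mem _
  | ι x =>
    rw [gradeHom_ι, coeff_monomial]
    split_ifs with h
    · subst h
      rw [pow_one]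
      exact ⟨x, rfl⟩
    · exact zero_mem _
  | mul a b ha hb =>
    rw [map_mul, coeff_mul]
    refine Submodule.sum_mem _ fun p hp => ?_
    rw [← Finset.HasAntidiagonal.mem_antidiagonal.mp hp, pow_add]
    exact Submodule.mul_mem_mul (ha _) (hb _)
  | add a b ha hb =>
    rw [map_add, coeff_add]
    exact add_mem (ha n) (hb n)

theorem gradeHom_of_mem {n : ℕ} {a : S}
    (ha : a ∈ LinearMap.range (SymmetricAlgebra.ι k M) ^ n) :
    gradeHom k M a = monomial n a := by
  induction ha using Submodule.pow_induction_on_right' with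
  | algebraMap r => simp [Polynomial.algebraMap_apply]
  | add x y i _ _ hx hy => rw [map_add, hx, hy, map_add]
  | mul_mem i x hx h m hm =>
    obtain ⟨y, rfl⟩ := hm
    rw [map_mul, h, gradeHom_ι, monomial_mul_monomial]

theorem pow_le_symLT (n : ℕ) :
    LinearMap.range (SymmetricAlgebra.ι k M) ^ n ≤ symLT k M (n + 1) := fun a ha =>
  mem_symLT.mpr fun m hm => by
    rw [gradeHom_of_mem ha, coeff_monomial, if_neg (by omega)]

theorem eq_zero_of_mem_symLT {n : ℕ} {a : S}
    (ha : a ∈ LinearMap.range (SymmetricAlgebra.ι k M) ^ n) (h : a ∈ symLT k M n) : a = 0 := by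
  simpa [gradeHom_of_mem ha] using mem_symLT.mp h n le_rfl

theorem symLT_succ_le (n : ℕ) :
    symLT k M (n + 1) ≤ LinearMap.range (SymmetricAlgebra.ι k M) ^ n ⊔ symLT k M n := by
  intro a ha
  have hc := coeff_gradeHom_mem a n
  -- Split off the homogeneous part of degree `n`; what remains has degree below `n`.
  rw [← add_sub_cancel ((gradeHom k M a).coeff n) a]
  refine Submodule.add_mem_sup hc (mem_symLT.mpr fun m hm => ?_)
  rw [map_sub, gradeHom_of_mem hc, coeff_sub, coeff_monomial]
  split_ifs with h
  · rw [h, sub_self]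
  · rw [mem_symLT.mp ha m (by omega), sub_zero]

/-! ### Derivations as coderivations -/

/-- The action of a linear endomorphism `f` on a tensor square, `f ⊗ 1 + 1 ⊗ f`. -/
def tensorSq {N : Type*} [AddCommGroup N] [Module k N] (f : N →ₗ[k] N) :
    N ⊗[k] N →ₗ[k] N ⊗[k] N :=
  f.rTensor N + f.lTensor N

theorem tensorSq_tmul {N : Type*} [AddCommGroup N] [Module k N] (f : N →ₗ[k] N) (a b : N) :
    tensorSq f (a ⊗ₜ[k] b) = f a ⊗ₜ[k] b + a ⊗ₜ[k] f b := by
  simp [tensorSq]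

theorem tensorSq_derivation_mul {A : Type*} [CommRing A] [Algebra k A] (D : Derivation k A A)
    (s t : A ⊗[k] A) :
    tensorSq D.toLinearMap (s * t)
      = s * tensorSq D.toLinearMap t + tensorSq D.toLinearMap s * t := by
  induction s using TensorProduct.induction_on with
  | zero => simp
  | add s₁ s₂ h₁ h₂ => simp only [add_mul, map_add, h₁, h₂]; ring
  | tmul a b =>
    induction t using TensorProduct.induction_on with
    | zero => simp
    | add t₁ t₂ h₁ h₂ => simp only [mul_add, map_add, h₁, h₂]; ring
    | tmul c d =>
      simp only [Algebra.TensorProduct.tmul_mul_tmul, tensorSq_tmul, Derivation.coeFn_coe, Derivation.leibniz, smul_eq_mul, mul_add, add_mul,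
        TensorProduct.add_tmul, TensorProduct.tmul_add, mul_comm c (D a), mul_comm d (D b)]
      abel

/-- Since `D ⊗ 1 + 1 ⊗ D` is a derivation of the tensor square and the coproduct is multiplicative,
it suffices to compare on generators, where `D x = f x` is again primitive. -/
theorem comul_symDeriv (f : M →ₗ[k] M) (a : S) :
    comul (R := k) (symDeriv (SymmetricAlgebra.ι k M ∘ₗ f) a)
      = tensorSq (symDeriv (SymmetricAlgebra.ι k M ∘ₗ f)).toLinearMap (comul (R := k) a) := by
  induction a using SymmetricAlgebra.induction with
  | algebraMap r =>
    simp [Algebra.algebraMap_eq_smul_one, Algebra.TensorProduct.one_def, tensorSq_tmul]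
  | ι x => simp [tensorSq_tmul]
  | mul a b ha hb =>
    rw [Bialgebra.comul_mul, tensorSq_derivation_mul, ← ha, ← hb, Derivation.leibniz, map_add,
      smul_eq_mul, smul_eq_mul, Bialgebra.comul_mul, Bialgebra.comul_mul,
      mul_comm (comul (R := k) b)]
  | add a b ha hb => simp only [map_add, ha, hb]

theorem counit_symDeriv (f : M →ₗ[k] M) (a : S) :
    counit (R := k) (symDeriv (SymmetricAlgebra.ι k M ∘ₗ f) a) = 0 := by
  induction a using SymmetricAlgebra.induction with
  | algebraMap r => simp
  | ι x => rw [symDeriv_ι]; exact SymmetricAlgebra.counit_ι (R := k) (M := M) (f x)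
  | mul a b ha hb =>
    rw [Derivation.leibniz, map_add, smul_eq_mul, smul_eq_mul, Bialgebra.counit_mul,
      Bialgebra.counit_mul, ha, hb, mul_zero, mul_zero, add_zero]
  | add a b ha hb => rw [map_add, map_add, ha, hb, add_zero]

end Sym

/-! ## The action of the enveloping algebra of a pre-Lie algebra on its symmetric algebra -/

section PreLie

variable (k : Type u) [CommRing k] {g : Type v} [RightPreLieRing g] [RightPreLieAlgebra k g]

local notation "S" => SymmetricAlgebra k g
local notation "ι" => SymmetricAlgebra.ι k g

/-- The derivation of the symmetric algebra extending right multiplication by `y`. -/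
def preLieDeriv (y : g) : Derivation k S S := symDeriv (ι ∘ₗ LinearMap.mulRight k y)

/-- The right action of `y` on the symmetric algebra: multiplication by `y` plus the derivation
extending right multiplication by `y`. -/
def preLieAct (y : g) : Module.End k S :=
  LinearMap.mulRight k (ι y) + (preLieDeriv k y).toLinearMap

variable {k}

@[simp]
theorem preLieDeriv_ι (x y : g) : preLieDeriv k y (ι x) = ι (x * y) := by
  simp [preLieDeriv]

theorem preLieAct_apply (y : g) (a : S) : preLieAct k y a = a * ι y + preLieDeriv k y a := rfl

theorem preLieDeriv_add (y z : g) : preLieDeriv k (y + z) = preLieDeriv k y + preLieDeriv k z :=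
  symDerivation_ext fun x => by simp [mul_add]

theorem preLieDeriv_smul (r : k) (y : g) : preLieDeriv k (r • y) = r • preLieDeriv k y :=
  symDerivation_ext fun x => by simp [mul_smul_comm]

/-- On generators this is the pre-Lie identity, rearranged as `x ∘ (y ∘ z - z ∘ y) = (x ∘ y) ∘ z -
(x ∘ z) ∘ y`. -/
theorem preLieDeriv_lie (y z : g) :
    preLieDeriv k ⁅y, z⁆ = ⁅preLieDeriv k z, preLieDeriv k y⁆ :=
  symDerivation_ext fun x => by
    have h := RightPreLieRing.assoc_symm' x y z
    simp only [associator_apply] at h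
    rw [Derivation.commutator_apply]
    simp only [preLieDeriv_ι, Ring.lie_def, ← map_sub, mul_sub]
    congr 1
    rw [← sub_eq_zero] at h ⊢
    rw [← neg_eq_zero, ← h]
    abel

/-- In the expansion the terms symmetric in `y` and `z` cancel. What survives is `a · (y ∘ z) - a ·
(z ∘ y)`, which is multiplication by the bracket, and the commutator of the two derivations. -/
theorem preLieAct_lie (y z : g) (a : S) :
    preLieAct k ⁅y, z⁆ a = preLieAct k z (preLieAct k y a) - preLieAct k y (preLieAct k z a) := by
  rw [preLieAct_apply, preLieDeriv_lie, Derivation.commutator_apply, Ring.lie_def]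
  simp only [preLieAct_apply, map_add, Derivation.leibniz, preLieDeriv_ι, map_sub, smul_eq_mul]
  ring

variable (k g)

/-- The right action of the enveloping algebra on the symmetric algebra. -/
def preLieActHom : U k g →ₐ[k] (Module.End k S)ᵐᵒᵖ :=
  UniversalEnvelopingAlgebra.lift k
    { toFun := fun y => MulOpposite.op (preLieAct k y)
      map_add' := fun y z => by
        rw [← MulOpposite.op_add]
        congr 1
        ext a : 1
        simp only [preLieAct_apply, LinearMap.add_apply, preLieDeriv_add, map_add, mul_add,
          Derivation.add_apply]
        abel
      map_smul' := fun r y => by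
        rw [RingHom.id_apply, ← MulOpposite.op_smul]
        congr 1
        ext a : 1
        simp only [preLieAct_apply, LinearMap.smul_apply, preLieDeriv_smul, map_smul,
          Derivation.smul_apply, smul_add, mul_smul_comm]
      map_lie' := fun {y z} => by
        change MulOpposite.op (preLieAct k ⁅y, z⁆)
          = MulOpposite.op (preLieAct k z * preLieAct k y - preLieAct k y * preLieAct k z)
        congr 1
        ext a : 1
        exact preLieAct_lie y z a }

/-- The linear map `U → Sym` given by the action on `1`. -/
def toSym : U k g →ₗ[k] S :=
  LinearMap.applyₗ (1 : S) ∘ₗ (MulOpposite.opLinearEquiv k).symm.toLinearMap ∘ₗ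
    (preLieActHom k g).toLinearMap

variable {k g}

theorem preLieActHom_incl (y : g) :
    preLieActHom k g (incl k g y) = MulOpposite.op (preLieAct k y) :=
  lift_incl _ y

theorem toSym_apply (u : U k g) : toSym k g u = (preLieActHom k g u).unop 1 := rfl

theorem toSym_one : toSym k g 1 = 1 := by
  rw [toSym_apply, map_one (preLieActHom k g)]; rfl

theorem toSym_algebraMap (r : k) : toSym k g (algebraMap k (U k g) r) = algebraMap k S r := by
  rw [Algebra.algebraMap_eq_smul_one, map_smul, toSym_one, Algebra.algebraMap_eq_smul_one]

theorem toSym_mul_incl (u : U k g) (y : g) :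
    toSym k g (u * incl k g y) = preLieAct k y (toSym k g u) := by
  rw [toSym_apply, map_mul, preLieActHom_incl]; rfl

/-- Both summands of the action are coderivations: multiplication by `y` because `y` is primitive,
and the derivation by `comul_symDeriv`. -/
theorem comul_preLieAct (y : g) (a : S) :
    comul (R := k) (preLieAct k y a) = tensorSq (preLieAct k y) (comul (R := k) a) := by
  have h : ∀ t : S ⊗[k] S, tensorSq (preLieAct k y) t
      = t * (ι y ⊗ₜ[k] 1 + 1 ⊗ₜ[k] ι y) + tensorSq (preLieDeriv k y).toLinearMap t := by
    intro t
    induction t using TensorProduct.induction_on with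
    | zero => simp
    | add s t hs ht => simp only [map_add, hs, ht]; ring
    | tmul a b =>
      simp only [tensorSq_tmul, preLieAct_apply, mul_add, Algebra.TensorProduct.tmul_mul_tmul,
        mul_one, TensorProduct.add_tmul, TensorProduct.tmul_add, Derivation.coeFn_coe]
      abel
  rw [h, preLieAct_apply, map_add, Bialgebra.comul_mul, SymmetricAlgebra.comul_ι, preLieDeriv,
    comul_symDeriv]

theorem map_toSym_mul_primitive (y : g) (t : U k g ⊗[k] U k g) :
    TensorProduct.map (toSym k g) (toSym k g) (t * (incl k g y ⊗ₜ[k] 1 + 1 ⊗ₜ[k] incl k g y))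
      = tensorSq (preLieAct k y) (TensorProduct.map (toSym k g) (toSym k g) t) := by
  induction t using TensorProduct.induction_on with
  | zero => simp
  | add s t hs ht => simp only [add_mul, map_add, hs, ht]
  | tmul a b =>
    simp only [mul_add, Algebra.TensorProduct.tmul_mul_tmul, mul_one, map_add,
      TensorProduct.map_tmul, toSym_mul_incl, tensorSq_tmul]

theorem comul_toSym (u : U k g) :
    comul (R := k) (toSym k g u)
      = TensorProduct.map (toSym k g) (toSym k g) (comul (R := k) u) := by
  obtain ⟨n, hn⟩ := exists_mem_F u
  induction hn using F_induction with
  | algebraMap r =>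
    simp [Algebra.algebraMap_eq_smul_one, Algebra.TensorProduct.one_def, toSym_one]
  | add n a b _ _ ha hb => simp only [map_add, ha, hb]
  | smul_succ n a r _ h => simp only [map_smul, h]
  | mul_incl n a x _ h =>
    rw [toSym_mul_incl, comul_preLieAct, h, Bialgebra.comul_mul, comul_incl,
      map_toSym_mul_primitive]

theorem counit_toSym (u : U k g) : counit (R := k) (toSym k g u) = counit (R := k) u := by
  obtain ⟨n, hn⟩ := exists_mem_F u
  induction hn using F_induction with
  | algebraMap r => rw [toSym_algebraMap, Bialgebra.counit_algebraMap, Bialgebra.counit_algebraMap]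
  | add n a b _ _ ha hb => simp only [map_add, ha, hb]
  | smul_succ n a r _ h => simp only [map_smul, h]
  | mul_incl n a x _ h =>
    rw [toSym_mul_incl, preLieAct_apply, map_add, preLieDeriv, counit_symDeriv,
      Bialgebra.counit_mul, SymmetricAlgebra.counit_ι, Bialgebra.counit_mul, counit_incl,
      mul_zero, mul_zero, add_zero]

variable (k g)

/-- `toSym` as a morphism of coalgebras. -/
def toSymCoalgHom : U k g →ₗc[k] S where
  __ := toSym k g
  counit_comp := LinearMap.ext counit_toSym
  map_comp_comul := LinearMap.ext fun u => (comul_toSym u).symm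

variable {k g}

/-! ## Comparison of the filtrations -/

/-- The bound `symLT` is strict, so `F n` corresponds to `symLT (n + 1)`, and `Fprev n` to `symLT
n`, both zero at `n = 0`. -/
theorem toSym_mem_symLT {n : ℕ} {u : U k g} (hu : u ∈ F k g n) :
    toSym k g u ∈ symLT k g (n + 1) := by
  induction hu using F_induction with
  | algebraMap r =>
    rw [toSym_algebraMap]
    refine pow_le_symLT 0 ?_
    rw [pow_zero]
    exact Submodule.algebraMap_mem r
  | add n a b _ _ ha hb => rw [map_add]; exact add_mem ha hb
  | smul_succ n a r _ h =>
    rw [map_smul]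
    exact Submodule.smul_mem _ _ (symLT_mono (Nat.le_succ _) h)
  | mul_incl n a x _ h =>
    rw [toSym_mul_incl, preLieAct_apply]
    exact add_mem (mul_ι_mem_symLT h x)
      (symLT_mono (Nat.le_succ _) (symDeriv_mem_symLT _ h))

theorem toSym_mem_symLT_of_mem_Fprev {n : ℕ} {u : U k g} (hu : u ∈ Fprev k g n) :
    toSym k g u ∈ symLT k g n := by
  cases n with
  | zero =>
    have h : u = 0 := hu
    rw [h, map_zero]
    exact zero_mem _
  | succ n => exact toSym_mem_symLT hu

/-- `a ∈ Symⁿ` represents the class of `u` in `F n / F (n - 1)`, and is the leading term of the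
image of `u` in `Sym`. -/
structure IsSymbol (n : ℕ) (a : S) (u : U k g) : Prop where
  mem_symPart : a ∈ symPart k g n
  mem_F : u ∈ F k g n
  sub_mem : toSym k g u - a ∈ symLT k g n
  canonicalMap_eq : canonicalMap k g a = DirectSum.of (GrPiece k g) n (symb k g n ⟨u, mem_F⟩)

namespace IsSymbol

theorem of_algebraMap (r : k) :
    IsSymbol (g := g) 0 (algebraMap k S r) (algebraMap k (U k g) r) where
  mem_symPart := by rw [symPart, pow_zero]; exact Submodule.algebraMap_mem r
  mem_F := algebraMap_mem_F r
  sub_mem := by rw [toSym_algebraMap, sub_self]; exact zero_mem _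
  canonicalMap_eq := AlgHom.commutes _ r

theorem add {n : ℕ} {a b : S} {u v : U k g} (h₁ : IsSymbol n a u) (h₂ : IsSymbol n b v) :
    IsSymbol n (a + b) (u + v) where
  mem_symPart := add_mem h₁.mem_symPart h₂.mem_symPart
  mem_F := add_mem h₁.mem_F h₂.mem_F
  sub_mem := by
    rw [map_add, add_sub_add_comm]
    exact add_mem h₁.sub_mem h₂.sub_mem
  canonicalMap_eq := by
    rw [map_add, h₁.canonicalMap_eq, h₂.canonicalMap_eq, ← map_add, ← map_add]
    rfl

/-- This covers the elements whose nominal degree exceeds their true one, as produced by the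
constant part of a factor in `k + L`. -/
theorem zero_of_mem {n : ℕ} {u : U k g} (hu : u ∈ F k g n) : IsSymbol (n + 1) 0 u where
  mem_symPart := zero_mem _
  mem_F := F_le_succ n hu
  sub_mem := by rw [sub_zero]; exact toSym_mem_symLT hu
  canonicalMap_eq := by
    have h : symb k g (n + 1) ⟨u, F_le_succ n hu⟩ = 0 :=
      (symb_eq_zero_iff _).mpr hu
    rw [h, map_zero, map_zero]

theorem mul_ι {n : ℕ} {a : S} {u : U k g} (h : IsSymbol n a u) (x : g) :
    IsSymbol (n + 1) (a * ι x) (u * incl k g x) where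
  mem_symPart := by
    rw [symPart, pow_succ]
    exact Submodule.mul_mem_mul h.mem_symPart ⟨x, rfl⟩
  mem_F := mul_incl_mem_F h.mem_F x
  sub_mem := by
    rw [toSym_mul_incl, preLieAct_apply, add_sub_right_comm, ← sub_mul]
    -- The product with `x` carries the leading term; the derivation leaves degrees at most `n`,
    -- which are absorbed in the error of degree below `n + 1`.
    exact add_mem (mul_ι_mem_symLT h.sub_mem x)
      (symDeriv_mem_symLT _ (toSym_mem_symLT h.mem_F))
  canonicalMap_eq := by
    have hx : canonicalMap k g (ι x)
        = DirectSum.of (GrPiece k g) 1 (symb k g 1 ⟨incl k g x, incl_mem_F x⟩) :=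
      SymmetricAlgebra.lift_ι_apply _ x
    rw [map_mul, h.canonicalMap_eq, hx, DirectSum.of_mul_of]
    rfl

theorem exists_right {n : ℕ} {a : S} (ha : a ∈ symPart k g n) : ∃ u, IsSymbol n a u := by
  induction ha using Submodule.pow_induction_on_right' with
  | algebraMap r => exact ⟨_, of_algebraMap r⟩
  | add x y i _ _ hx hy =>
    obtain ⟨u, hu⟩ := hx
    obtain ⟨v, hv⟩ := hy
    exact ⟨_, hu.add hv⟩
  | mul_mem i x hx h m hm =>
    obtain ⟨y, rfl⟩ := hm
    obtain ⟨u, hu⟩ := h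
    exact ⟨_, hu.mul_ι y⟩

theorem exists_left {n : ℕ} {u : U k g} (hu : u ∈ F k g n) : ∃ a, IsSymbol n a u := by
  induction hu using F_induction with
  | algebraMap r => exact ⟨_, of_algebraMap r⟩
  | add n u v _ _ hu hv =>
    obtain ⟨a, ha⟩ := hu
    obtain ⟨b, hb⟩ := hv
    exact ⟨_, ha.add hb⟩
  | smul_succ n u r hu _ => exact ⟨0, zero_of_mem (Submodule.smul_mem _ r hu)⟩
  | mul_incl n u x _ h =>
    obtain ⟨a, ha⟩ := h
    exact ⟨_, ha.mul_ι x⟩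

/-- Leading terms are unique, since a nonzero element of degree `n` cannot have degree below `n`.
Hence `IsSymbol` can stay a relation, with no well-definedness to check. -/
theorem eq_of_sub_mem {n : ℕ} {a : S} {u : U k g} (h : IsSymbol n a u)
    {b : S} (hb : b ∈ symPart k g n)
    (hub : toSym k g u - b ∈ symLT k g n) : a = b := by
  rw [← sub_eq_zero]
  refine eq_zero_of_mem_symLT (_root_.sub_mem h.mem_symPart hb) ?_
  rw [← sub_sub_sub_cancel_left _ _ (toSym k g u)]
  exact _root_.sub_mem hub h.sub_mem

theorem eq_zero_of_mem_Fprev {n : ℕ} {a : S} {u : U k g} (h : IsSymbol n a u)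
    (hu : u ∈ Fprev k g n) : a = 0 :=
  h.eq_of_sub_mem (zero_mem _) (by rw [sub_zero]; exact toSym_mem_symLT_of_mem_Fprev hu)

theorem mem_Fprev {n : ℕ} {a : S} {u : U k g} (h : IsSymbol n a u)
    (ha : canonicalMap k g a = 0) : u ∈ Fprev k g n := by
  have h₁ := h.canonicalMap_eq.symm.trans (ha.trans (map_zero (DirectSum.of (GrPiece k g) n)).symm)
  exact (symb_eq_zero_iff h.mem_F).mp (DirectSum.of_injective n h₁)

end IsSymbol

/-! ### Bijectivity of `toSym` and quantum PBW -/

theorem toSym_injective : Function.Injective (toSym k g) := by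
  refine (injective_iff_map_eq_zero _).mpr fun u hu => ?_
  have key : ∀ n, u ∈ Fprev k g n → u = 0 := by
    intro n
    induction n with
    | zero => exact id
    | succ n ih =>
      intro hn
      obtain ⟨a, ha⟩ := IsSymbol.exists_left (show u ∈ F k g n from hn)
      -- As `toSym u = 0`, its leading term vanishes. Then so does the class of `u`, and `u` drops
      -- one step in the filtration.
      have h0 : a = 0 := ha.eq_of_sub_mem (zero_mem _) (by rw [hu, sub_zero]; exact zero_mem _)
      exact ih (ha.mem_Fprev (by rw [h0, map_zero]))
  obtain ⟨n, hn⟩ := exists_mem_F u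
  exact key (n + 1) hn

/-- Surjectivity with control of the filtration, so that the inverse of `toSym` is filtered as well:
lift the top homogeneous part, and correct the lower-degree error by induction. -/
theorem symLT_le_map (n : ℕ) : symLT k g n ≤ (Fprev k g n).map (toSym k g) := by
  induction n with
  | zero => rw [symLT_zero]; exact bot_le
  | succ n ih =>
    have hF : (Fprev k g n).map (toSym k g) ≤ (F k g n).map (toSym k g) := by
      refine Submodule.map_mono ?_
      cases n with
      | zero => exact bot_le
      | succ n => exact F_le_succ n
    refine (symLT_succ_le n).trans (sup_le (fun a ha => ?_) (ih.trans hF))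
    obtain ⟨u, hu⟩ := IsSymbol.exists_right ha
    rw [← sub_sub_cancel (toSym k g u) a]
    exact sub_mem (Submodule.mem_map_of_mem hu.mem_F) (hF (ih hu.sub_mem))

theorem toSym_surjective : Function.Surjective (toSym k g) := fun a => by
  obtain ⟨n, hn⟩ := exists_mem_symLT a
  obtain ⟨u, _, hu⟩ := symLT_le_map n hn
  exact ⟨u, hu⟩

variable (k g)

/-- The coalgebra isomorphism `U ≃ Sym`. -/
def toSymEquiv : U k g ≃ₗc[k] S :=
  CoalgEquiv.ofBijective (f := toSymCoalgHom k g) ⟨toSym_injective, toSym_surjective⟩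

theorem liftsCanonicalMap_toSymEquiv_symm :
    LiftsCanonicalMap k g (toSymEquiv k g).symm.toLinearEquiv.toLinearMap := by
  intro n x hx
  change ∃ h : (toSymEquiv k g).symm x ∈ F k g n, _
  have hu : toSym k g ((toSymEquiv k g).symm x) = x := (toSymEquiv k g).apply_symm_apply x
  obtain ⟨v, hv, hvx⟩ := symLT_le_map (n + 1) (pow_le_symLT n hx)
  have hmem : (toSymEquiv k g).symm x ∈ F k g n := by
    rw [← toSym_injective (hvx.trans hu.symm)]
    exact hv
  obtain ⟨a, ha⟩ := IsSymbol.exists_left hmem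
  -- The image of this preimage is `x` with no error term, so `x` is its own leading term.
  obtain rfl : a = x := ha.eq_of_sub_mem hx (by rw [hu, sub_self]; exact zero_mem _)
  exact ⟨hmem, ha.canonicalMap_eq⟩

/-! ### Graded PBW: bijectivity of the canonical map -/

variable {k g}

theorem canonicalMap_apply_eq_zero {n m : ℕ} (hnm : n ≤ m) {a : S} (ha : a ∈ symLT k g n) :
    canonicalMap k g a m = 0 := by
  induction n generalizing a with
  | zero =>
    rw [symLT_zero, Submodule.mem_bot] at ha
    rw [ha, map_zero]
    rfl
  | succ n ih =>
    obtain ⟨b, hb, c, hc, rfl⟩ := Submodule.mem_sup.mp (symLT_succ_le n ha)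
    obtain ⟨u, hu⟩ := IsSymbol.exists_right hb
    rw [map_add, DirectSum.add_apply, ih (by omega) hc, hu.canonicalMap_eq,
      DirectSum.of_eq_of_ne _ _ _ (by omega), add_zero]

theorem canonicalMap_injective : Function.Injective (canonicalMap k g) := by
  refine (injective_iff_map_eq_zero _).mpr fun a ha => ?_
  have key : ∀ n, a ∈ symLT k g n → a = 0 := by
    intro n
    induction n with
    | zero => rw [symLT_zero, Submodule.mem_bot]; exact id
    | succ n ih =>
      intro hn
      obtain ⟨b, hb, c, hc, rfl⟩ := Submodule.mem_sup.mp (symLT_succ_le n hn)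
      obtain ⟨u, hu⟩ := IsSymbol.exists_right hb
      -- The component of degree `n` sees only the top part `b`, and equals the class of `u`. Its
      -- vanishing puts `u` in `Fprev n`, which forces `b = 0`.
      have h := congrArg (fun x : Gr k g => x n) ha
      simp only [map_add, DirectSum.add_apply, canonicalMap_apply_eq_zero le_rfl hc, add_zero,
        hu.canonicalMap_eq, DirectSum.of_eq_same, DirectSum.zero_apply] at h
      have hb0 : b = 0 := hu.eq_zero_of_mem_Fprev ((symb_eq_zero_iff hu.mem_F).mp h)
      refine ih ?_
      rw [hb0, zero_add]
      exact hc
  obtain ⟨n, hn⟩ := exists_mem_symLT a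
  exact key n hn

theorem canonicalMap_surjective : Function.Surjective (canonicalMap k g) := fun x => by
  induction x using DirectSum.induction_on with
  | zero => exact ⟨0, map_zero _⟩
  | of n x =>
    obtain ⟨u, rfl⟩ := symb_surj x
    obtain ⟨a, ha⟩ := IsSymbol.exists_left u.2
    exact ⟨a, ha.canonicalMap_eq⟩
  | add x y hx hy =>
    obtain ⟨a, rfl⟩ := hx
    obtain ⟨b, rfl⟩ := hy
    exact ⟨a + b, map_add _ _ _⟩

variable (k g)

theorem satisfiesPBW_of_rightPreLie : SatisfiesPBW k g where
  filteredHopf := isHopfFiltration_F k g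
  graded := ⟨canonicalMap_injective, canonicalMap_surjective⟩
  quantum := ⟨(toSymEquiv k g).symm, liftsCanonicalMap_toSymEquiv_symm k g⟩

end PreLie

end PreLiePBW

end

theorem corollary1p3 (k : Type*) [CommRing k] :
    (∀ (g : Type*) [RightPreLieRing g] [RightPreLieAlgebra k g], PreLiePBW.SatisfiesPBW k g) ∧
    (∀ (A : Type*) [NonUnitalRing A] [Module k A] [IsScalarTower k A A] [SMulCommClass k A A],
      letI := PreLiePBW.rightPreLieRingOfAssociative A
      letI := PreLiePBW.rightPreLieAlgebraOfAssociative k A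
      PreLiePBW.SatisfiesPBW k A) := by
  refine ⟨fun g _ _ => PreLiePBW.satisfiesPBW_of_rightPreLie k g, fun A _ _ _ _ => ?_⟩
  let := PreLiePBW.rightPreLieRingOfAssociative A
  let := PreLiePBW.rightPreLieAlgebraOfAssociative k A
  exact PreLiePBW.satisfiesPBW_of_rightPreLie k A
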